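/- Let $n\ge 0$, let $z_1,\dots,z_n\in\mathbb R^3$ be pairwise distinct points and $\alpha_1,\dots,\alpha_n\in\mathbb R$. Let $E\in\mathbb C$, and let $\sqrt E$ denote a fixed square root of $E$, with $\sqrt E\ge 0$ if $E\ge 0$. Put $$G^+(r,E)=-\frac{e^{i\sqrt E\,r}}{4\pi r},\qquad r>0,$$ and let $A=(A_{j,j'})$ be the $n\times n$ matrix with $A_{j,j}=\alpha_j-\frac{i\sqrt E}{4\pi}$ and $A_{j,j'}=G^+(|z_j-z_{j'}|,E)$ for $j'\ne j$. Let $\psi$ be a complex-valued function on $\mathbb R^3\setminus\{z_1,\dots,z_n\}$. The following two statements are equivalent. (i) $\psi$ is twice continuously differentiable and satisfies $-\Delta\psi=E\psi$ on $\mathbb R^3\setminus\{z_1,\dots,z_n\}$, and for every $j=1,\dots,n$ there are $\psi_{j,-1},\psi_{j,0}\in\mathbb C$ such that $$\psi(x)=\frac{\psi_{j,-1}}{|x-z_j|}+\psi_{j,0}+O(|x-z_j|)\quad\text{as } x\to z_j,\qquad \psi_{j,0}=4\pi\alpha_j\,\psi_{j,-1}.$$ (ii) There are a twice continuously differentiable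 function $\psi_0:\mathbb R^3\to\mathbb C$ with $-\Delta\psi_0=E\psi_0$ on all of $\mathbb R^3$ and a vector $q=(q_1,\dots,q_n)^t\in\mathbb C^n$ such that $$\psi(x)=\psi_0(x)+\sum_{j=1}^n q_j\,G^+(|x-z_j|,E)\quad\text{for all } x\in\mathbb R^3\setminus\{z_1,\dots,z_n\}$$ and $A q=\phi$, where $\phi=(\phi_1,\dots,\phi_n)^t$, $\phi_j=-\psi_0(z_j)$. -/

import Mathlib

open scoped Laplacian Topology

/-- Three-dimensional Euclidean space. -/
abbrev R3 : Type := EuclideanSpace ℝ (Fin 3)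

/-- `ψ` is a classical (`C²`) solution of `-Δψ = Eψ` on the open set `U`. Since `U` is open, this
depends only on the values of `ψ` on `U`. -/
def SolvesHelmholtzOn (E : ℂ) (U : Set R3) (ψ : R3 → ℂ) : Prop :=
  ContDiffOn ℝ 2 ψ U ∧ ∀ x ∈ U, -(Δ ψ) x = E * ψ x

/-- The point-scatterer condition at `z` with parameter `α`:
`ψ(x) = a / |x - z| + b + O(|x - z|)` as `x → z`, `x ≠ z`, with `b = 4πα a`. -/
def PointScattererCondition (z : R3) (α : ℝ) (ψ : R3 → ℂ) : Prop :=
  ∃ a b : ℂ,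
    ((fun x : R3 => ψ x - (a / (‖x - z‖ : ℂ) + b)) =O[𝓝[≠] z] fun x : R3 => ‖x - z‖) ∧
    b = 4 * (Real.pi : ℂ) * (α : ℂ) * a

/-- `ψ` solves the stationary Schrödinger equation at energy `E` with the multipoint scatterer
given by the positions `z j` and the parameters `α j`. -/
def SolvesMultipoint {n : ℕ} (z : Fin n → R3) (α : Fin n → ℝ) (E : ℂ) (ψ : R3 → ℂ) : Prop :=
  SolvesHelmholtzOn E (Set.range z)ᶜ ψ ∧ ∀ j, PointScattererCondition (z j) (α j) ψ

/-- `G⁺(r, E) = - exp (i √E r) / (4 π r)`, as a function of the root `κ = √E` and of `r > 0`. -/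
noncomputable def greenPlus (κ : ℂ) (r : ℝ) : ℂ :=
  -(Complex.exp (Complex.I * κ * (r : ℂ)) / (4 * (Real.pi : ℂ) * (r : ℂ)))

/-- The matrix with `α j - i √E / (4π)` on the diagonal and `G⁺(|z j - z j'|, E)` off it,
where `κ = √E`. -/
noncomputable def scattererMatrix {n : ℕ} (z : Fin n → R3) (α : Fin n → ℝ) (κ : ℂ) :
    Matrix (Fin n) (Fin n) ℂ :=
  Matrix.of fun j j' =>
    if j' = j then (α j : ℂ) - Complex.I * κ / (4 * (Real.pi : ℂ))
    else greenPlus κ ‖z j - z j'‖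

/-! The function `G⁺(|x - z|)` solves the Helmholtz equation off `z` and behaves there like
`-1/(4πr) - iκ/(4π) + O(r)`. Hence near `z j` the sum `∑ q G⁺` has singular coefficient `-q j/(4π)`
and constant term `(Aq) j - α j q j` (`sum_greenPlus_expansion`). Adding a regular `ψ₀`, the
condition `b = 4πα a` reads `ψ₀(z j) + (Aq) j = 0`, which is the linear system; this gives (ii) ⇒
(i).

Conversely, `q j = -4π a j` cancels the singularities of `ψ`, and the difference extends
continuously by `-(Aq) j` at `z j`. What remains is that finite sets are removable for continuous
solutions (`solvesHelmholtzOn_univ_of_finset`). Such a solution is a weak solution across the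
points, because a cutoff at scale `δ` contributes only `O(δ)`. Testing with the difference of two
truncations of `e^{iκr}/r` shows that a mean over a spherical shell does not depend on its radius.
Letting one radius tend to `0` writes the solution as a nonzero constant times its convolution with
a smooth kernel, so it is `C²`. The equation then extends by density. -/

open MeasureTheory

/-! ### Partial derivatives and Green's identity -/

/-- The `i`-th partial derivative of a function on `R3`. -/
noncomputable def partialDeriv (i : Fin 3) (f : R3 → ℂ) (x : R3) : ℂ :=
  fderiv ℝ f x (EuclideanSpace.single i 1)

theorem laplacian_eq_sum_partialDeriv {f : R3 → ℂ} {x : R3}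
    (hf : DifferentiableAt ℝ (fderiv ℝ f) x) :
    Δ f x = ∑ i, partialDeriv i (partialDeriv i f) x := by
  rw [InnerProductSpace.laplacian_eq_iteratedFDeriv_orthonormalBasis f
    (EuclideanSpace.basisFun (Fin 3) ℝ)]
  refine Finset.sum_congr rfl fun i _ => ?_
  rw [iteratedFDeriv_two_apply]
  have h : partialDeriv i f = fun y => fderiv ℝ f y (EuclideanSpace.single i 1) := rfl
  rw [partialDeriv, h, fderiv_clm_apply hf (differentiableAt_const _)]
  simp

theorem ContDiffAt.laplacian_eq_sum_partialDeriv {f : R3 → ℂ} {x : R3}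
    (hf : ContDiffAt ℝ 2 f x) : Δ f x = ∑ i, partialDeriv i (partialDeriv i f) x :=
  _root_.laplacian_eq_sum_partialDeriv
    ((hf.fderiv_right (m := 1) (by norm_num)).differentiableAt (by norm_num))

theorem ContDiffAt.partialDeriv {f : R3 → ℂ} {x : R3} (hf : ContDiffAt ℝ 2 f x) (i : Fin 3) :
    ContDiffAt ℝ 1 (partialDeriv i f) x :=
  (hf.fderiv_right (m := 1) (by norm_num)).clm_apply contDiffAt_const

theorem Filter.EventuallyEq.partialDeriv {f g : R3 → ℂ} {x : R3} (h : f =ᶠ[𝓝 x] g) (i : Fin 3) :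
    _root_.partialDeriv i f =ᶠ[𝓝 x] _root_.partialDeriv i g := by
  filter_upwards [h.fderiv (𝕜 := ℝ)] with y hy
  simp only [_root_.partialDeriv, hy]

theorem partialDeriv_eq_zero_of_notMem_tsupport {f : R3 → ℂ} {x : R3} (hx : x ∉ tsupport f)
    (i : Fin 3) : partialDeriv i f x = 0 := by
  have h := (notMem_tsupport_iff_eventuallyEq.mp hx).fderiv_eq (𝕜 := ℝ)
  simp [partialDeriv, h]

/-- The integral of a partial derivative of a compactly supported function vanishes. -/
theorem integral_partialDeriv_eq_zero {F : R3 → ℂ} (hF : ContDiff ℝ 1 F)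
    (hc : HasCompactSupport F) (i : Fin 3) :
    Integrable (partialDeriv i F) ∧ ∫ x, partialDeriv i F x = 0 := by
  have hcont : Continuous (partialDeriv i F) :=
    (hF.continuous_fderiv (by norm_num)).clm_apply continuous_const
  have hcs : HasCompactSupport (partialDeriv i F) :=
    hc.mono' fun x hx => by
      by_contra h
      exact hx (partialDeriv_eq_zero_of_notMem_tsupport h i)
  have hint : Integrable (partialDeriv i F) := hcont.integrable_of_hasCompactSupport hcs
  refine ⟨hint, ?_⟩
  -- Integration by parts against the constant `1`.
  have h := integral_mul_fderiv_eq_neg_fderiv_mul_of_integrable (μ := (volume : Measure R3))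
    (f := fun _ : R3 => (1 : ℂ)) (g := F) (v := EuclideanSpace.single i 1)
    (by simp) (by simpa [partialDeriv] using show Integrable (fun x => partialDeriv i F x) from hint)
    (by simpa using hF.continuous.integrable_of_hasCompactSupport hc)
    (fun x _ => differentiableAt_const _) (fun x _ => hF.differentiable (by norm_num) x)
  simpa [partialDeriv] using h

/-- Green's second identity, for a compactly supported test function. -/
theorem integral_green_eq_zero {u v : R3 → ℂ} (hv : ContDiff ℝ 2 v) (hc : HasCompactSupport v)
    (hu : ∀ x ∈ tsupport v, ContDiffAt ℝ 2 u x) :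
    ∫ x, (u x * Δ v x - v x * Δ u x) = 0 := by
  -- The integrand is the divergence of `u∇v - v∇u`. This field vanishes near each point off
  -- `tsupport v`, so `u` may be singular there.
  set F : Fin 3 → R3 → ℂ := fun i x => u x * partialDeriv i v x - v x * partialDeriv i u x with hF
  have hF0 : ∀ i x, x ∉ tsupport v → F i =ᶠ[𝓝 x] 0 := fun i x hx => by
    have h := notMem_tsupport_iff_eventuallyEq.mp hx
    filter_upwards [h, h.partialDeriv i] with y h1 h2
    simp only [hF, h1, h2]
    simp [partialDeriv]
  have hFd : ∀ i, ContDiff ℝ 1 (F i) := fun i => contDiff_iff_contDiffAt.mpr fun x => by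
    by_cases hx : x ∈ tsupport v
    · exact (((hu x hx).of_le (by norm_num)).mul (hv.contDiffAt.partialDeriv i)).sub
        ((hv.contDiffAt.of_le (by norm_num)).mul ((hu x hx).partialDeriv i))
    · exact contDiffAt_const.congr_of_eventuallyEq (hF0 i x hx)
  have hFc : ∀ i, HasCompactSupport (F i) := fun i => hc.mono' fun x hx => by
    by_contra h
    exact hx (hF0 i x h).eq_of_nhds
  have hpt : ∀ x, u x * Δ v x - v x * Δ u x = ∑ i, partialDeriv i (F i) x := fun x => by
    by_cases hx : x ∈ tsupport v
    · rw [(hu x hx).laplacian_eq_sum_partialDeriv,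
        hv.contDiffAt.laplacian_eq_sum_partialDeriv, Finset.mul_sum, Finset.mul_sum,
        ← Finset.sum_sub_distrib]
      refine Finset.sum_congr rfl fun i _ => ?_
      have d1 := ((hu x hx).differentiableAt (by norm_num)).hasFDerivAt
      have d2 := (hv.differentiable (by norm_num) x).hasFDerivAt
      have d3 := (((hu x hx).partialDeriv i).differentiableAt (by norm_num)).hasFDerivAt
      have d4 := ((hv.contDiffAt (x := x).partialDeriv i).differentiableAt (by norm_num)).hasFDerivAt
      have := ((d1.mul d4).sub (d2.mul d3)).fderiv
      conv_rhs => rw [partialDeriv]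
      rw [show F i = u * partialDeriv i v - v * partialDeriv i u from rfl, this]
      simp [partialDeriv]
      ring
    · have h := notMem_tsupport_iff_eventuallyEq.mp hx
      have h1 := (InnerProductSpace.laplacian_congr_nhds h).eq_of_nhds
      have h2 : ∀ i, partialDeriv i (F i) x = 0 := fun i => by
        rw [((hF0 i x hx).partialDeriv i).eq_of_nhds]
        simp [partialDeriv]
      rw [h1, h.eq_of_nhds, Finset.sum_eq_zero fun i _ => h2 i]
      simp [InnerProductSpace.laplacian_eq_iteratedFDeriv_stdOrthonormalBasis]
  simp_rw [hpt]
  rw [integral_finsetSum _ fun i _ => (integral_partialDeriv_eq_zero (hFd i) (hFc i) i).1]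
  exact Finset.sum_eq_zero fun i _ => (integral_partialDeriv_eq_zero (hFd i) (hFc i) i).2

/-- If `u` solves the Helmholtz equation on the support of a test function `v`, then it solves it
weakly when tested against `v`. -/
theorem integral_mul_helmholtz_eq_zero {u v : R3 → ℂ} {E : ℂ} (hv : ContDiff ℝ 2 v)
    (hc : HasCompactSupport v)
    (hu : ∀ x ∈ tsupport v, ContDiffAt ℝ 2 u x ∧ -Δ u x = E * u x) :
    ∫ x, u x * (Δ v x + E * v x) = 0 := by
  rw [← integral_green_eq_zero hv hc fun x hx => (hu x hx).1]
  refine integral_congr_ae (Filter.Eventually.of_forall fun x => ?_)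
  by_cases hx : x ∈ tsupport v
  · linear_combination v x * (hu x hx).2.symm
  · simp only [image_eq_zero_of_notMem_tsupport hx]
    ring

/-! ### The Laplacian of radial functions -/

theorem hasFDerivAt_norm_sub {x z : R3} (hx : x ≠ z) :
    HasFDerivAt (fun y : R3 => ‖y - z‖) (‖x - z‖⁻¹ • innerSL ℝ (x - z)) x := by
  have h : (0 : ℝ) < ‖x - z‖ := norm_pos_iff.mpr (sub_ne_zero.mpr hx)
  have h1 := ((hasStrictFDerivAt_norm_sq (x - z)).hasFDerivAt.comp x
    ((hasFDerivAt_id x).sub_const z)).sqrt (by simpa using h.ne')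
  have : (fun y : R3 => √(((fun w : R3 => ‖w‖ ^ 2) ∘ fun y => id y - z) y)) =
      fun y : R3 => ‖y - z‖ := by
    ext y; simp
  rw [this] at h1
  refine h1.congr_fderiv ?_
  ext v
  simp [Real.sqrt_sq h.le]
  field_simp

theorem partialDeriv_comp_norm {k : ℝ → ℂ} {k' : ℂ} {x z : R3} (hx : x ≠ z)
    (hk : HasDerivAt k k' ‖x - z‖) (i : Fin 3) :
    partialDeriv i (fun y => k ‖y - z‖) x = k' / ‖x - z‖ * ((x - z) i : ℝ) := by
  have h := (hk.hasFDerivAt.comp x (hasFDerivAt_norm_sub hx)).fderiv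
  rw [partialDeriv, show (fun y => k ‖y - z‖) = k ∘ fun y : R3 => ‖y - z‖ from rfl, h]
  simp [EuclideanSpace.inner_single_right]
  ring

/-- The Laplacian of `g(r) / r`, where `r` is the distance to `z`, is `g''(r) / r`. -/
theorem laplacian_radial {g g' g'' : ℝ → ℂ} (hg : ∀ r, HasDerivAt g (g' r) r)
    (hg' : ∀ r, HasDerivAt g' (g'' r) r) {x z : R3} (hx : x ≠ z)
    (hd : ContDiffAt ℝ 2 (fun y => g ‖y - z‖ / ‖y - z‖) x) :
    Δ (fun y => g ‖y - z‖ / ‖y - z‖) x = g'' ‖x - z‖ / ‖x - z‖ := by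
  have hpos : ∀ y, y ≠ z → (‖y - z‖ : ℂ) ≠ 0 := fun y hy => by
    simpa [sub_eq_zero] using hy
  have hr : ∀ r : ℝ, HasDerivAt (fun r : ℝ => (r : ℂ)) 1 r := fun r =>
    Complex.ofRealCLM.hasDerivAt
  -- With `c = (g/r)'/r` the gradient of `g/r` is `c(r)(x - z)`, whose divergence is `r c' + 3c =
  -- g''/r`.
  set c : ℝ → ℂ := fun r => (g' r * r - g r) / r ^ 3 with hc
  have h1 : ∀ i, ∀ᶠ y in 𝓝 x, partialDeriv i (fun y => g ‖y - z‖ / ‖y - z‖) y =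
      c ‖y - z‖ * ((y - z) i : ℝ) := fun i => by
    filter_upwards [isOpen_ne.mem_nhds hx] with y hy
    rw [partialDeriv_comp_norm (k := fun r => g r / r) hy ((hg _).div (hr _) (hpos y hy)) i]
    simp only [hc]
    have := hpos y hy
    field_simp
  have h2 : HasDerivAt c (((g'' ‖x - z‖ * ‖x - z‖ + g' ‖x - z‖ * 1 - g' ‖x - z‖) * ‖x - z‖ ^ 3 -
      (g' ‖x - z‖ * ‖x - z‖ - g ‖x - z‖) * (3 * ‖x - z‖ ^ 2 * 1)) / (‖x - z‖ ^ 3 : ℂ) ^ 2) ‖x - z‖ := by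
    refine (((hg' _).mul (hr _)).sub (hg _)).div ?_ (pow_ne_zero 3 (hpos x hx))
    simpa [Pi.pow_def] using (hr ‖x - z‖).pow 3
  have h3 : ∀ i, partialDeriv i (partialDeriv i (fun y => g ‖y - z‖ / ‖y - z‖)) x =
      deriv c ‖x - z‖ / ‖x - z‖ * (((x - z) i : ℝ) : ℂ) ^ 2 + c ‖x - z‖ := fun i => by
    rw [(Filter.EventuallyEq.partialDeriv (h1 i) i).eq_of_nhds]
    have e1 := HasFDerivAt.comp (f := fun y : R3 => ‖y - z‖) x h2.hasFDerivAt
      (hasFDerivAt_norm_sub hx)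
    have e2 : HasFDerivAt (fun y : R3 => (((y - z) i : ℝ) : ℂ))
        (Complex.ofRealCLM.comp (EuclideanSpace.proj i)) x :=
      (Complex.ofRealCLM.comp (EuclideanSpace.proj i : R3 →L[ℝ] ℝ)).hasFDerivAt.comp x
        ((hasFDerivAt_id x).sub_const z)
    have e3 := partialDeriv_comp_norm hx h2 i
    rw [show (fun y => c ‖y - z‖) = c ∘ fun y : R3 => ‖y - z‖ from rfl, partialDeriv,
      e1.fderiv] at e3
    rw [show (fun y => c ‖y - z‖ * (((y - z) i : ℝ) : ℂ)) =
      (c ∘ fun y : R3 => ‖y - z‖) * fun y : R3 => (((y - z) i : ℝ) : ℂ) from rfl,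
      partialDeriv, (e1.mul e2).fderiv, h2.deriv]
    simp only [add_apply, smul_apply, e3]
    simp
    ring
  have h4 : ∑ i, (((x - z) i : ℝ) : ℂ) ^ 2 = (‖x - z‖ : ℂ) ^ 2 := by
    have := EuclideanSpace.real_norm_sq_eq (x - z)
    exact_mod_cast this.symm
  rw [hd.laplacian_eq_sum_partialDeriv, Finset.sum_congr rfl fun i _ => h3 i,
    Finset.sum_add_distrib, ← Finset.mul_sum, h4, h2.deriv]
  have := hpos x hx
  simp only [Finset.sum_const, Finset.card_univ, Fintype.card_fin, nsmul_eq_mul, hc]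
  field_simp
  push_cast
  ring

/-! ### Rescaling and continuity of the Laplacian -/

theorem partialDeriv_comp_affine {f : R3 → ℂ} (s : R3) (δ : ℝ) (w : R3)
    (hf : DifferentiableAt ℝ f (s + δ • w)) (i : Fin 3) :
    partialDeriv i (fun w => f (s + δ • w)) w = δ * partialDeriv i f (s + δ • w) := by
  have h := hf.hasFDerivAt.comp w (((hasFDerivAt_id (𝕜 := ℝ) w).const_smul δ).const_add s)
  have h' := h.fderiv
  rw [partialDeriv, show (fun w => f (s + δ • w)) = f ∘ fun w => s + (δ • id) w from rfl, h']
  simp [partialDeriv]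

theorem laplacian_comp_affine {f : R3 → ℂ} (hf : ContDiff ℝ 2 f) (s : R3) (δ : ℝ) (w : R3) :
    Δ (fun w => f (s + δ • w)) w = δ ^ 2 * Δ f (s + δ • w) := by
  have hc : ContDiff ℝ 2 fun w => f (s + δ • w) :=
    hf.comp (contDiff_const.add (contDiff_id.const_smul δ))
  rw [hc.contDiffAt.laplacian_eq_sum_partialDeriv, hf.contDiffAt.laplacian_eq_sum_partialDeriv,
    Finset.mul_sum]
  refine Finset.sum_congr rfl fun i _ => ?_
  have h1 : partialDeriv i (fun w => f (s + δ • w)) =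
      fun w => ((δ : ℝ) : ℂ) * partialDeriv i f (s + δ • w) := by
    ext w
    exact partialDeriv_comp_affine s δ w (hf.differentiable (by norm_num) _) i
  have hd : ∀ y, DifferentiableAt ℝ (partialDeriv i f) y := fun y =>
    (hf.contDiffAt.partialDeriv i).differentiableAt (by norm_num)
  have h2 := partialDeriv_comp_affine s δ w (hd _) i
  have hd' : DifferentiableAt ℝ (fun w => partialDeriv i f (s + δ • w)) w :=
    (hd _).comp w (((differentiableAt_id (𝕜 := ℝ)).const_smul δ).const_add s)
  rw [h1, partialDeriv, fderiv_const_mul hd']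
  rw [partialDeriv] at h2
  rw [smul_apply, h2, smul_eq_mul]
  ring

/-- Joint continuity lets rescaled integrals be controlled down to scale `0`. -/
theorem continuous_laplacian_uncurry {H : ℝ → R3 → ℂ} (hH : ContDiff ℝ 2 (Function.uncurry H)) :
    Continuous fun p : ℝ × R3 => Δ (H p.1) p.2 := by
  have h0 : ContDiff ℝ 2 (Function.uncurry fun (p : ℝ × R3) (w : R3) => H p.1 w) :=
    hH.comp (f := fun q : (ℝ × R3) × R3 => (q.1.1, q.2)) (by fun_prop)
  have h1 : ∀ i, ContDiff ℝ 1 fun p : ℝ × R3 => partialDeriv i (H p.1) p.2 := fun i =>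
    (ContDiff.fderiv h0 contDiff_snd (by norm_num)).clm_apply contDiff_const
  have h2 : ∀ i, ContDiff ℝ 0 fun p : ℝ × R3 =>
      partialDeriv i (partialDeriv i (H p.1)) p.2 := fun i => by
    have h3 : ContDiff ℝ 1
        (Function.uncurry fun (p : ℝ × R3) (w : R3) => partialDeriv i (H p.1) w) :=
      (h1 i).comp (f := fun q : (ℝ × R3) × R3 => (q.1.1, q.2)) (by fun_prop)
    exact (ContDiff.fderiv h3 contDiff_snd (by norm_num)).clm_apply contDiff_const
  have h4 : (fun p : ℝ × R3 => Δ (H p.1) p.2) =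
      fun p => ∑ i, partialDeriv i (partialDeriv i (H p.1)) p.2 := by
    ext p
    have : ContDiff ℝ 2 (H p.1) :=
      hH.comp (f := fun w : R3 => (p.1, w)) (by fun_prop)
    exact this.contDiffAt.laplacian_eq_sum_partialDeriv
  rw [h4]
  exact continuous_finsetSum _ fun i _ => (h2 i).continuous

theorem laplacian_eq_zero_of_notMem_tsupport {f : R3 → ℂ} {x : R3} (hx : x ∉ tsupport f) :
    Δ f x = 0 := by
  rw [(InnerProductSpace.laplacian_congr_nhds (notMem_tsupport_iff_eventuallyEq.mp hx)).eq_of_nhds]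
  simp [InnerProductSpace.laplacian_eq_iteratedFDeriv_stdOrthonormalBasis]

theorem ContDiff.continuous_laplacian {f : R3 → ℂ} (hf : ContDiff ℝ 2 f) : Continuous (Δ f) := by
  have h := continuous_laplacian_uncurry (H := fun _ => f) (hf.comp contDiff_snd)
  exact h.comp (f := fun x : R3 => ((0 : ℝ), x)) (by fun_prop)

/-- The affine change of variables `y = s + δ w` on `R3`. -/
theorem integral_comp_affine (F : R3 → ℂ) (s : R3) {δ : ℝ} (hδ : 0 < δ) :
    ∫ y, F y = δ ^ 3 * ∫ w, F (s + δ • w) := by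
  have h := Measure.integral_comp_smul_of_nonneg (volume : Measure R3) (fun w => F (s + w)) δ
    (hR := hδ.le)
  rw [h, integral_add_left_eq_self (μ := (volume : Measure R3)) F s]
  have hδ' : (δ : ℂ) ≠ 0 := by exact_mod_cast hδ.ne'
  simp
  field_simp

/-! ### Weak solutions across finitely many points -/

/-- A continuous solution of the Helmholtz equation off a finite set is a weak solution across
that set. -/
theorem integral_mul_helmholtz_eq_zero_of_finset {u : R3 → ℂ} {E : ℂ} (hu : Continuous u)
    (T : Finset R3) {v : R3 → ℂ} (hv : ContDiff ℝ 2 v) (hc : HasCompactSupport v)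
    (huv : ∀ x ∈ tsupport v, x ∉ T → ContDiffAt ℝ 2 u x ∧ -Δ u x = E * u x) :
    ∫ x, u x * (Δ v x + E * v x) = 0 := by
  classical
  induction T using Finset.induction_on generalizing v with
  | empty => exact integral_mul_helmholtz_eq_zero hv hc fun x hx => huv x hx (by simp)
  | insert s T hs ih =>
    let b : ContDiffBump (0 : R3) := ⟨1, 2, by norm_num, by norm_num⟩
    have hb : ContDiff ℝ 2 fun w : R3 => (b w : ℂ) :=
      Complex.ofRealCLM.contDiff.comp b.contDiff
    -- The part of `v` near `s` in the variable `w = (y - s)/δ`; it is `C²` in `(δ, w)` even at `δ =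
    -- 0`, so `J` below is continuous there.
    set H : ℝ → R3 → ℂ := fun δ w => b w * v (s + δ • w) with hH
    have hHd : ContDiff ℝ 2 (Function.uncurry H) :=
      (hb.comp contDiff_snd).mul (hv.comp (f := fun p : ℝ × R3 => s + p.1 • p.2) (by fun_prop))
    have hHs : ∀ δ w, w ∉ Metric.closedBall (0 : R3) 2 → w ∉ tsupport (H δ) := fun δ w hw h => by
      refine hw ?_
      rw [← b.tsupport_eq]
      refine closure_mono (fun y hy => ?_) h
      rw [Function.mem_support] at hy ⊢
      intro h0
      exact hy (by simp [hH, h0])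
    set J : ℝ → ℂ := fun δ => ∫ w in Metric.closedBall (0 : R3) 2,
      u (s + δ • w) * (Δ (H δ) w + δ ^ 2 * E * H δ w) with hJ
    have hJc : Continuous J := by
      refine continuous_parametric_integral_of_continuous
        (f := fun δ w => u (s + δ • w) * (Δ (H δ) w + δ ^ 2 * E * H δ w)) ?_
        (isCompact_closedBall _ _)
      have h1 := continuous_laplacian_uncurry hHd
      have h2 := hHd.continuous
      have h3 : Continuous fun p : ℝ × R3 => u (s + p.1 • p.2) := hu.comp (by fun_prop)
      have h4 : Continuous fun p : ℝ × R3 => ((p.1 : ℝ) : ℂ) ^ 2 * E := by fun_prop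
      exact h3.mul (h1.add (h4.mul h2))
    have hint : ∀ {f : R3 → ℂ}, ContDiff ℝ 2 f → HasCompactSupport f →
        Integrable fun x => u x * (Δ f x + E * f x) := fun {f} hf hcf => by
      refine (hu.mul (hf.continuous_laplacian.add
        (continuous_const.mul hf.continuous))).integrable_of_hasCompactSupport (hcf.mono' ?_)
      intro x hx
      by_contra h
      exact hx (by
        simp [laplacian_eq_zero_of_notMem_tsupport h, image_eq_zero_of_notMem_tsupport h])
    -- Split `v = f + g` with `f` supported within `2δ` of `s`. Since `g` vanishes near `s`, the
    -- induction hypothesis disposes of it; for `f` the volume factor `δ³` meets `δ⁻²` from the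
    -- Laplacian.
    have key : ∀ δ : ℝ, 0 < δ → ∫ x, u x * (Δ v x + E * v x) = δ * J δ := fun δ hδ => by
      set f : R3 → ℂ := fun y => b (δ⁻¹ • (y - s)) * v y with hf
      set g : R3 → ℂ := fun y => (1 - b (δ⁻¹ • (y - s))) * v y with hg
      have hbs : ContDiff ℝ 2 fun y : R3 => (b (δ⁻¹ • (y - s)) : ℂ) :=
        hb.comp (f := fun y : R3 => δ⁻¹ • (y - s)) (by fun_prop)
      have hfd : ContDiff ℝ 2 f := hbs.mul hv
      have hgd : ContDiff ℝ 2 g := (contDiff_const.sub hbs).mul hv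
      have hfc : HasCompactSupport f := hc.mul_left
      have hgc : HasCompactSupport g := hc.mul_left
      have hvfg : v = f + g := by
        ext y; simp only [hf, hg, Pi.add_apply]; ring
      have hg0 : ∫ x, u x * (Δ g x + E * g x) = 0 := by
        refine ih hgd hgc fun x hx hxT => huv x ?_ ?_
        · refine closure_mono (fun y hy => ?_) hx
          rw [Function.mem_support] at hy ⊢
          intro h0
          exact hy (by simp [hg, h0])
        · rw [Finset.mem_insert, not_or]
          refine ⟨?_, hxT⟩
          rintro rfl
          refine notMem_tsupport_iff_eventuallyEq.mpr ?_ hx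
          filter_upwards [Metric.ball_mem_nhds x hδ] with y hy
          have : b (δ⁻¹ • (y - x)) = 1 := by
            refine b.one_of_mem_closedBall ?_
            rw [mem_ball_iff_norm] at hy
            rw [mem_closedBall_zero_iff, norm_smul, norm_inv, Real.norm_of_nonneg hδ.le]
            exact (inv_mul_le_one₀ hδ).mpr hy.le
          simp [hg, this]
      have hfa : ∀ w, f (s + δ • w) = H δ w := fun w => by
        simp [hf, hH, smul_smul, inv_mul_cancel₀ hδ.ne']
      have hfl : ∀ w, (δ : ℂ) ^ 2 * Δ f (s + δ • w) = Δ (H δ) w := fun w => by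
        rw [← laplacian_comp_affine hfd, funext hfa]
      have hsplit : ∀ x, u x * (Δ v x + E * v x) =
          u x * (Δ f x + E * f x) + u x * (Δ g x + E * g x) := fun x => by
        rw [hvfg, hfd.contDiffAt.laplacian_add hgd.contDiffAt, Pi.add_apply]
        ring
      simp_rw [hsplit]
      rw [integral_add (hint hfd hfc) (hint hgd hgc), hg0, add_zero,
        integral_comp_affine _ s hδ]
      simp only [hJ]
      rw [setIntegral_eq_integral_of_forall_compl_eq_zero,
        ← integral_const_mul, ← integral_const_mul]
      · refine integral_congr_ae (Filter.Eventually.of_forall fun w => ?_)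
        simp only [← hfl, hfa]
        ring
      · intro w hw
        simp [laplacian_eq_zero_of_notMem_tsupport (hHs δ w hw),
          image_eq_zero_of_notMem_tsupport (hHs δ w hw)]
    have hlim : Filter.Tendsto (fun δ : ℝ => (δ : ℂ) * J δ) (𝓝[>] 0) (𝓝 0) := by
      have : Continuous fun δ : ℝ => (δ : ℂ) * J δ := Complex.continuous_ofReal.mul hJc
      have h := this.tendsto 0
      simp only [Complex.ofReal_zero, zero_mul] at h
      exact h.mono_left nhdsWithin_le_nhds
    refine tendsto_nhds_unique (tendsto_const_nhds.congr' ?_) hlim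
    filter_upwards [self_mem_nhdsWithin] with δ hδ using key δ hδ

/-! ### Radial test functions and the cutoff -/

theorem contDiffAt_radial {m : ℕ∞} {f : ℝ → ℂ} (hf : ContDiff ℝ m f) {x z : R3} (hx : x ≠ z) :
    ContDiffAt ℝ m (fun y => f ‖y - z‖ / ‖y - z‖) x := by
  have h0 : x - z ≠ 0 := sub_ne_zero.mpr hx
  have hn : ContDiffAt ℝ m (fun y : R3 => ‖y - z‖) x :=
    ContDiffAt.norm ℝ (f := fun y : R3 => y - z) (contDiffAt_id.sub contDiffAt_const) h0
  have hn' : ContDiffAt ℝ m (fun y : R3 => ((‖y - z‖ : ℝ) : ℂ)) x :=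
    Complex.ofRealCLM.contDiff.contDiffAt.comp x hn
  have h1 : ((‖x - z‖ : ℝ) : ℂ) ≠ 0 := by simpa using h0
  have hfn : ContDiffAt ℝ m (fun y : R3 => f ‖y - z‖) x := hf.contDiffAt.comp x hn
  simp_rw [div_eq_mul_inv]
  exact hfn.mul (hn'.inv h1)

theorem contDiff_radial {m : ℕ∞} {f : ℝ → ℂ} (hf : ContDiff ℝ m f) {ε : ℝ} (hε : 0 < ε)
    (h0 : ∀ r < ε, f r = 0) (z : R3) :
    ContDiff ℝ m (fun y : R3 => f ‖y - z‖ / ‖y - z‖) := by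
  refine contDiff_iff_contDiffAt.mpr fun x => ?_
  by_cases hx : x = z
  · subst hx
    refine (contDiffAt_const (c := (0 : ℂ))).congr_of_eventuallyEq ?_
    filter_upwards [Metric.ball_mem_nhds x hε] with y hy
    rw [mem_ball_iff_norm] at hy
    rw [h0 _ hy, zero_div]
  · exact contDiffAt_radial hf hx

theorem hasCompactSupport_radial {f : ℝ → ℂ} {R : ℝ} (h : ∀ r > R, f r = 0) (z : R3) :
    HasCompactSupport (fun y : R3 => f ‖y - z‖ / ‖y - z‖) := by
  refine HasCompactSupport.intro (isCompact_closedBall z R) fun y hy => ?_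
  rw [mem_closedBall_iff_norm, not_le] at hy
  rw [h _ hy, zero_div]

/-- A smooth complex-valued cutoff which is `0` on `r ≤ 1` and `1` on `2 ≤ r`. -/
noncomputable def cutoff (r : ℝ) : ℂ := (Real.smoothTransition (r - 1) : ℂ)

theorem contDiff_cutoff {m : ℕ∞} : ContDiff ℝ m cutoff :=
  Complex.ofRealCLM.contDiff.comp
    (Real.smoothTransition.contDiff.comp (contDiff_id.sub contDiff_const))

theorem contDiff_deriv_cutoff {m : ℕ∞} : ContDiff ℝ m (deriv cutoff) := by
  have h : ContDiff ℝ (m + 1 : ℕ∞) cutoff := contDiff_cutoff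
  exact (contDiff_succ_iff_deriv.mp (by exact_mod_cast h)).2.2

theorem contDiff_deriv_deriv_cutoff {m : ℕ∞} : ContDiff ℝ m (deriv (deriv cutoff)) := by
  have h : ContDiff ℝ (m + 1 : ℕ∞) (deriv cutoff) := contDiff_deriv_cutoff
  exact (contDiff_succ_iff_deriv.mp (by exact_mod_cast h)).2.2

theorem hasDerivAt_cutoff (r : ℝ) : HasDerivAt cutoff (deriv cutoff r) r :=
  ((contDiff_cutoff (m := 1)).differentiable (by norm_num) r).hasDerivAt

theorem hasDerivAt_deriv_cutoff (r : ℝ) :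
    HasDerivAt (deriv cutoff) (deriv (deriv cutoff) r) r :=
  ((contDiff_deriv_cutoff (m := 1)).differentiable (by norm_num) r).hasDerivAt

theorem cutoff_eq_zero {r : ℝ} (hr : r < 1) : cutoff r = 0 := by
  simp [cutoff, Real.smoothTransition.zero_of_nonpos (sub_nonpos.mpr hr.le)]

theorem cutoff_eq_one {r : ℝ} (hr : 2 < r) : cutoff r = 1 := by
  simp [cutoff, Real.smoothTransition.one_of_one_le (show 1 ≤ r - 1 by linarith)]

theorem deriv_cutoff_eq_zero_of_lt {r : ℝ} (hr : r < 1) : deriv cutoff r = 0 := by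
  have h : cutoff =ᶠ[𝓝 r] fun _ => 0 := by
    filter_upwards [Iio_mem_nhds hr] with s hs using cutoff_eq_zero hs
  simp [h.deriv_eq]

theorem deriv_cutoff_eq_zero_of_gt {r : ℝ} (hr : 2 < r) : deriv cutoff r = 0 := by
  have h : cutoff =ᶠ[𝓝 r] fun _ => 1 := by
    filter_upwards [Ioi_mem_nhds hr] with s hs using cutoff_eq_one hs
  simp [h.deriv_eq]

theorem deriv_deriv_cutoff_eq_zero_of_lt {r : ℝ} (hr : r < 1) : deriv (deriv cutoff) r = 0 := by
  have h : deriv cutoff =ᶠ[𝓝 r] fun _ => 0 := by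
    filter_upwards [Iio_mem_nhds hr] with s hs using deriv_cutoff_eq_zero_of_lt hs
  simp [h.deriv_eq]

theorem deriv_deriv_cutoff_eq_zero_of_gt {r : ℝ} (hr : 2 < r) : deriv (deriv cutoff) r = 0 := by
  have h : deriv cutoff =ᶠ[𝓝 r] fun _ => 0 := by
    filter_upwards [Ioi_mem_nhds hr] with s hs using deriv_cutoff_eq_zero_of_gt hs
  simp [h.deriv_eq]

/-! ### Truncated spherical waves and the mean value kernel -/

theorem hasDerivAt_exp_I_mul (κ : ℂ) (r : ℝ) :
    HasDerivAt (fun r : ℝ => Complex.exp (Complex.I * κ * r))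
      (Complex.I * κ * Complex.exp (Complex.I * κ * r)) r := by
  have h := ((Complex.ofRealCLM.hasDerivAt (x := r)).const_mul (Complex.I * κ)).cexp
  simpa [mul_comm] using h

theorem contDiff_exp_I_mul {m : ℕ∞} (κ : ℂ) :
    ContDiff ℝ m (fun r : ℝ => Complex.exp (Complex.I * κ * r)) :=
  (contDiff_const.mul Complex.ofRealCLM.contDiff).cexp

/-- The numerator of the Green function cut off at distance `δ`. -/
noncomputable def cutoffWave (κ : ℂ) (δ r : ℝ) : ℂ :=
  cutoff (δ⁻¹ * r) * Complex.exp (Complex.I * κ * r)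

/-- `(d²/dr² + κ²)` applied to `cutoffWave κ δ`. -/
noncomputable def cutoffSource (κ : ℂ) (δ r : ℝ) : ℂ :=
  (deriv (deriv cutoff) (δ⁻¹ * r) * (δ⁻¹ : ℂ) ^ 2 +
    2 * Complex.I * κ * (δ⁻¹ : ℂ) * deriv cutoff (δ⁻¹ * r)) * Complex.exp (Complex.I * κ * r)

theorem contDiff_cutoffWave {m : ℕ∞} (κ : ℂ) (δ : ℝ) : ContDiff ℝ m (cutoffWave κ δ) :=
  (contDiff_cutoff.comp (contDiff_const.mul contDiff_id)).mul (contDiff_exp_I_mul κ)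

theorem contDiff_cutoffSource {m : ℕ∞} (κ : ℂ) (δ : ℝ) : ContDiff ℝ m (cutoffSource κ δ) :=
  (((contDiff_deriv_deriv_cutoff.comp (contDiff_const.mul contDiff_id)).mul contDiff_const).add
    (contDiff_const.mul (contDiff_deriv_cutoff.comp (contDiff_const.mul contDiff_id)))).mul
      (contDiff_exp_I_mul κ)

theorem cutoffSource_eq_zero_of_lt (κ : ℂ) {δ r : ℝ} (hδ : 0 < δ) (hr : r < δ) :
    cutoffSource κ δ r = 0 := by
  have h : δ⁻¹ * r < 1 := (inv_mul_lt_one₀ hδ).mpr hr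
  simp [cutoffSource, deriv_cutoff_eq_zero_of_lt h, deriv_deriv_cutoff_eq_zero_of_lt h]

theorem cutoffSource_eq_zero_of_gt (κ : ℂ) {δ r : ℝ} (hδ : 0 < δ) (hr : 2 * δ < r) :
    cutoffSource κ δ r = 0 := by
  have h : 2 < δ⁻¹ * r := by
    rw [inv_mul_eq_div, lt_div_iff₀ hδ]; exact hr
  simp [cutoffSource, deriv_cutoff_eq_zero_of_gt h, deriv_deriv_cutoff_eq_zero_of_gt h]

theorem hasDerivAt_cutoffWave (κ : ℂ) (δ r : ℝ) :
    HasDerivAt (cutoffWave κ δ) (((δ⁻¹ : ℂ) * deriv cutoff (δ⁻¹ * r) +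
      Complex.I * κ * cutoff (δ⁻¹ * r)) * Complex.exp (Complex.I * κ * r)) r := by
  have h1 : HasDerivAt (fun r => cutoff (δ⁻¹ * r)) ((δ⁻¹ : ℂ) * deriv cutoff (δ⁻¹ * r)) r := by
    simpa [Function.comp_def] using (hasDerivAt_cutoff (δ⁻¹ * r)).scomp r ((hasDerivAt_id r).const_mul δ⁻¹)
  refine (h1.mul (hasDerivAt_exp_I_mul κ r)).congr_deriv ?_
  ring

/-- Since `e^{iκr}` solves the radial equation, the source contains only terms with a derivative of
the cutoff, and so lives in the shell `δ ≤ r ≤ 2δ`. -/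
theorem hasDerivAt_deriv_cutoffWave (κ : ℂ) (δ r : ℝ) :
    HasDerivAt (fun r : ℝ => ((δ⁻¹ : ℂ) * deriv cutoff (δ⁻¹ * r) +
      Complex.I * κ * cutoff (δ⁻¹ * r)) * Complex.exp (Complex.I * κ * r))
      (cutoffSource κ δ r - κ ^ 2 * cutoffWave κ δ r) r := by
  have h1 : HasDerivAt (fun r => cutoff (δ⁻¹ * r)) ((δ⁻¹ : ℂ) * deriv cutoff (δ⁻¹ * r)) r := by
    simpa [Function.comp_def] using (hasDerivAt_cutoff (δ⁻¹ * r)).scomp r ((hasDerivAt_id r).const_mul δ⁻¹)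
  have h2 : HasDerivAt (fun r => deriv cutoff (δ⁻¹ * r))
      ((δ⁻¹ : ℂ) * deriv (deriv cutoff) (δ⁻¹ * r)) r := by
    simpa [Function.comp_def] using (hasDerivAt_deriv_cutoff (δ⁻¹ * r)).scomp r ((hasDerivAt_id r).const_mul δ⁻¹)
  refine (((h2.const_mul _).add (h1.const_mul _)).mul (hasDerivAt_exp_I_mul κ r)).congr_deriv ?_
  simp only [cutoffSource, cutoffWave, Pi.add_apply]
  linear_combination (κ ^ 2 * cutoff (δ⁻¹ * r) * Complex.exp (Complex.I * κ * r)) * Complex.I_sq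

/-- The smooth kernel, supported in a spherical shell, of the mean value property for solutions of
the Helmholtz equation, at scale `δ`. -/
noncomputable def meanKernel (κ : ℂ) (δ : ℝ) (w : R3) : ℂ :=
  (deriv (deriv cutoff) ‖w‖ / ‖w‖ + 2 * Complex.I * κ * δ * (deriv cutoff ‖w‖ / ‖w‖)) *
    Complex.exp (Complex.I * κ * δ * ‖w‖)

theorem meanKernel_one (κ : ℂ) (w : R3) : meanKernel κ 1 w = cutoffSource κ 1 ‖w‖ / ‖w‖ := by
  simp only [meanKernel, cutoffSource]
  push_cast
  simp only [inv_one, one_mul]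
  ring_nf

theorem continuous_meanKernel (κ : ℂ) :
    Continuous fun p : ℝ × R3 => meanKernel κ p.1 p.2 := by
  have h1 : Continuous fun w : R3 => deriv (deriv cutoff) ‖w‖ / ‖w‖ := by
    simpa using (contDiff_radial (m := 0) contDiff_deriv_deriv_cutoff one_pos
      (fun r hr => deriv_deriv_cutoff_eq_zero_of_lt hr) 0).continuous
  have h2 : Continuous fun w : R3 => deriv cutoff ‖w‖ / ‖w‖ := by
    simpa using (contDiff_radial (m := 0) contDiff_deriv_cutoff one_pos
      (fun r hr => deriv_cutoff_eq_zero_of_lt hr) 0).continuous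
  exact ((h1.comp continuous_snd).add (Continuous.mul (by fun_prop)
    (h2.comp continuous_snd))).mul (by fun_prop)

theorem meanKernel_eq_zero (κ : ℂ) (δ : ℝ) {w : R3} (hw : w ∉ Metric.closedBall (0 : R3) 2) :
    meanKernel κ δ w = 0 := by
  rw [mem_closedBall_zero_iff, not_le] at hw
  simp [meanKernel, deriv_cutoff_eq_zero_of_gt hw, deriv_deriv_cutoff_eq_zero_of_gt hw]

/-- The volume factor `δ³` exactly absorbs `δ⁻²` from the source and `δ⁻¹` from `1/r`, leaving a
kernel that is regular at `δ = 0`. -/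
theorem integral_mul_cutoffSource (κ : ℂ) (u : R3 → ℂ) (x : R3) {δ : ℝ} (hδ : 0 < δ) :
    ∫ y, u y * (cutoffSource κ δ ‖y - x‖ / ‖y - x‖) =
      ∫ w, u (x + δ • w) * meanKernel κ δ w := by
  rw [integral_comp_affine _ x hδ, ← integral_const_mul]
  refine integral_congr_ae (Filter.Eventually.of_forall fun w => ?_)
  have hδ' : (δ : ℂ) ≠ 0 := by exact_mod_cast hδ.ne'
  simp only [add_sub_cancel_left, norm_smul, Real.norm_of_nonneg hδ.le, cutoffSource, meanKernel,
    inv_mul_cancel_left₀ hδ.ne']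
  by_cases hw : (‖w‖ : ℂ) = 0
  · simp [hw]
  · push_cast
    rw [← mul_assoc (Complex.I * κ) (δ : ℂ)]
    field_simp

/-! ### Mean value property and removable singularities -/

/-- The mean value property of continuous functions which solve the Helmholtz equation off a
finite set. -/
theorem integral_mul_meanKernel {u : R3 → ℂ} {κ : ℂ} (hu : Continuous u) (T : Finset R3)
    (huT : ∀ x ∉ T, ContDiffAt ℝ 2 u x ∧ -Δ u x = κ ^ 2 * u x) (x : R3) :
    ∫ w, u (x + w) * meanKernel κ 1 w = u x * ∫ w, meanKernel κ 0 w := by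
  set J : ℝ → ℂ := fun δ => ∫ w in Metric.closedBall (0 : R3) 2,
    u (x + δ • w) * meanKernel κ δ w with hJ
  have hJc : Continuous J := by
    refine continuous_parametric_integral_of_continuous
      (f := fun δ w => u (x + δ • w) * meanKernel κ δ w) ?_ (isCompact_closedBall _ _)
    have h3 : Continuous fun p : ℝ × R3 => u (x + p.1 • p.2) := hu.comp (by fun_prop)
    exact h3.mul (continuous_meanKernel κ)
  have hJe : ∀ δ, J δ = ∫ w, u (x + δ • w) * meanKernel κ δ w := fun δ =>
    setIntegral_eq_integral_of_forall_compl_eq_zero fun w hw => by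
      rw [meanKernel_eq_zero κ δ hw, mul_zero]
  have hJ1 : ∀ δ : ℝ, 0 < δ → δ ≤ 1 → J 1 = J δ := fun δ hδ hδ1 => by
    -- Both waves vanish for `r < δ` and coincide for `r > 2`, so `g/r` is a test function; `Δ + κ²`
    -- maps it to the difference of the two sources over `r`.
    set g : ℝ → ℂ := fun r => cutoffWave κ 1 r - cutoffWave κ δ r with hg
    have hgd : ContDiff ℝ (2 : ℕ∞) g := (contDiff_cutoffWave κ 1).sub (contDiff_cutoffWave κ δ)
    have hg0 : ∀ r < δ, g r = 0 := fun r hr => by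
      have h1 : δ⁻¹ * r < 1 := (inv_mul_lt_one₀ hδ).mpr hr
      simp [hg, cutoffWave, cutoff_eq_zero h1, cutoff_eq_zero (hr.trans_le hδ1)]
    have hg2 : ∀ r > 2, g r = 0 := fun r hr => by
      have h1 : 2 < δ⁻¹ * r := by
        rw [inv_mul_eq_div, lt_div_iff₀ hδ]; nlinarith
      simp [hg, cutoffWave, cutoff_eq_one h1, cutoff_eq_one hr]
    have hWd := contDiff_radial hgd hδ hg0 x
    have hint : ∀ δ : ℝ, 0 < δ →
        Integrable fun y => u y * (cutoffSource κ δ ‖y - x‖ / ‖y - x‖) := fun δ hδ => by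
      refine (hu.mul (contDiff_radial (m := 0) (contDiff_cutoffSource κ δ) hδ
        (fun r hr => cutoffSource_eq_zero_of_lt κ hδ hr) x).continuous).integrable_of_hasCompactSupport
        ?_
      exact (hasCompactSupport_radial
        (fun r hr => cutoffSource_eq_zero_of_gt κ hδ hr) x).mul_left
    have hw := integral_mul_helmholtz_eq_zero_of_finset hu T hWd (hasCompactSupport_radial hg2 x)
      fun y _ hy => huT y hy
    rw [← sub_eq_zero, hJe, hJe, ← integral_mul_cutoffSource κ u x one_pos,
      ← integral_mul_cutoffSource κ u x hδ, ← integral_sub (hint 1 one_pos) (hint δ hδ), ← hw]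
    refine integral_congr_ae ?_
    filter_upwards [compl_mem_ae_iff.mpr (measure_singleton x)] with y hy
    have hyx : y ≠ x := by simpa using hy
    rw [laplacian_radial (g := g)
      (fun r => (hasDerivAt_cutoffWave κ 1 r).sub (hasDerivAt_cutoffWave κ δ r))
      (fun r => (hasDerivAt_deriv_cutoffWave κ 1 r).sub (hasDerivAt_deriv_cutoffWave κ δ r))
      hyx hWd.contDiffAt]
    simp only [hg]
    ring
  have hlim := (hJc.tendsto 0).mono_left (nhdsWithin_le_nhds (s := Set.Ioi 0))
  have h10 : J 1 = J 0 := by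
    refine tendsto_nhds_unique (tendsto_const_nhds.congr' ?_) hlim
    filter_upwards [Ioc_mem_nhdsGT one_pos] with δ hδ using hJ1 δ hδ.1 hδ.2
  rw [hJe, hJe] at h10
  simpa [integral_const_mul] using h10

/-- In polar coordinates the integral is a positive multiple of `∫ r χ'' dr = [r χ' - χ] = -1`,
where `χ` is the cutoff. -/
theorem integral_meanKernel_zero_ne_zero (κ : ℂ) : ∫ w, meanKernel κ 0 w ≠ 0 := by
  have h1 : ∀ w : R3, meanKernel κ 0 w = (fun r : ℝ => deriv (deriv cutoff) r / r) ‖w‖ := fun w => by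
    simp [meanKernel]
  have h2 : ∫ y in Set.Ioi (0 : ℝ), y • deriv (deriv cutoff) y = 0 - 1 - (0 - 0) := by
    have hd : ∀ y ∈ Set.Ici (0 : ℝ), HasDerivAt (fun y : ℝ => y • deriv cutoff y - cutoff y)
        (y • deriv (deriv cutoff) y) y := fun y _ => by
      refine (((hasDerivAt_id y).smul (hasDerivAt_deriv_cutoff y)).sub
        (hasDerivAt_cutoff y)).congr_deriv ?_
      simp
    have hi : Integrable fun y : ℝ => y • deriv (deriv cutoff) y := by
      refine (continuous_id.smul
        (contDiff_deriv_deriv_cutoff (m := 0)).continuous).integrable_of_hasCompactSupport ?_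
      refine HasCompactSupport.intro (isCompact_Icc (a := 1) (b := 2)) fun y hy => ?_
      rw [Set.mem_Icc, not_and_or, not_le, not_le] at hy
      rcases hy with hy | hy
      · simp [deriv_deriv_cutoff_eq_zero_of_lt hy]
      · simp [deriv_deriv_cutoff_eq_zero_of_gt hy]
    rw [integral_Ioi_of_hasDerivAt_of_tendsto' hd hi.integrableOn (m := 0 - 1)]
    · simp [cutoff_eq_zero]
    · refine tendsto_const_nhds.congr' ?_
      filter_upwards [Filter.Ioi_mem_atTop (2 : ℝ)] with y hy
      simp [deriv_cutoff_eq_zero_of_gt hy, cutoff_eq_one hy]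
  simp_rw [h1]
  rw [integral_fun_norm_addHaar (volume : Measure R3) fun r : ℝ => deriv (deriv cutoff) r / r]
  have h3 : ∫ y in Set.Ioi (0 : ℝ), y ^ (Module.finrank ℝ R3 - 1) • (deriv (deriv cutoff) y / y) =
      ∫ y in Set.Ioi (0 : ℝ), y • deriv (deriv cutoff) y := by
    refine setIntegral_congr_fun measurableSet_Ioi fun y hy => ?_
    have hy' : (y : ℂ) ≠ 0 := by exact_mod_cast (ne_of_gt hy)
    simp
    field_simp
  rw [h3, h2]
  have h4 : (volume : Measure R3).real (Metric.ball 0 1) ≠ 0 :=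
    (ENNReal.toReal_pos (Metric.measure_ball_pos _ _ one_pos).ne' measure_ball_lt_top.ne).ne'
  simp [h4]

/-- Finite sets are removable for continuous solutions of the Helmholtz equation. -/
theorem solvesHelmholtzOn_univ_of_finset {u : R3 → ℂ} {κ : ℂ} (hu : Continuous u) (T : Finset R3)
    (huT : ∀ x ∉ T, ContDiffAt ℝ 2 u x ∧ -Δ u x = κ ^ 2 * u x) :
    SolvesHelmholtzOn (κ ^ 2) Set.univ u := by
  have hK : ContDiff ℝ (2 : ℕ∞) (meanKernel κ 1) := by
    have h := contDiff_radial (m := 2) (contDiff_cutoffSource κ 1) one_pos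
      (fun r hr => cutoffSource_eq_zero_of_lt κ one_pos hr) 0
    simp only [sub_zero, ← meanKernel_one] at h
    exact h
  have hKc : HasCompactSupport (meanKernel κ 1) :=
    HasCompactSupport.intro (isCompact_closedBall 0 2) fun w hw => meanKernel_eq_zero κ 1 hw
  have hconv := hKc.contDiff_convolution_right (ContinuousLinearMap.mul ℝ ℂ)
    (hu.locallyIntegrable (μ := (volume : Measure R3))) hK
  have heq : u = fun x => (∫ w, meanKernel κ 0 w)⁻¹ *
      convolution u (meanKernel κ 1) (ContinuousLinearMap.mul ℝ ℂ) volume x := by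
    ext x
    have h := integral_mul_meanKernel hu T huT x
    have hs : convolution u (meanKernel κ 1) (ContinuousLinearMap.mul ℝ ℂ) volume x =
        ∫ w, u (x + w) * meanKernel κ 1 w := by
      rw [convolution, ← integral_add_left_eq_self _ x]
      -- The kernel is radial, hence even.
      refine integral_congr_ae (Filter.Eventually.of_forall fun w => ?_)
      simp [meanKernel]
    rw [hs, h, mul_comm (u x), inv_mul_cancel_left₀ (integral_meanKernel_zero_ne_zero κ)]
  have hud : ContDiff ℝ 2 u := by
    rw [heq]
    exact contDiff_const.mul hconv
  refine ⟨hud.contDiffOn, fun x _ => ?_⟩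
  -- Both sides of the equation are now continuous and agree on the dense complement of `T`.
  have hc1 : Continuous fun x => -Δ u x := hud.continuous_laplacian.neg
  have hc2 : Continuous fun x => κ ^ 2 * u x := continuous_const.mul hu
  have hdense : Dense ((T : Set R3)ᶜ) := T.finite_toSet.countable.dense_compl ℝ
  exact congrFun (hc1.ext_on hdense hc2 fun y hy => (huT y (by simpa using hy)).2) x

/-! ### The Green function: equation and expansion -/

theorem greenPlus_eq_radial (κ : ℂ) (r : ℝ) :
    greenPlus κ r = -(4 * (Real.pi : ℂ))⁻¹ * Complex.exp (Complex.I * κ * r) / r := by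
  simp only [greenPlus, div_eq_mul_inv, mul_inv]
  ring

theorem contDiffAt_greenPlus (κ : ℂ) {x z : R3} (hx : x ≠ z) :
    ContDiffAt ℝ 2 (fun y => greenPlus κ ‖y - z‖) x := by
  simp_rw [greenPlus_eq_radial]
  exact contDiffAt_radial (m := 2)
    (f := fun r => -(4 * (Real.pi : ℂ))⁻¹ * Complex.exp (Complex.I * κ * r))
    (contDiff_const.mul (contDiff_exp_I_mul κ)) hx

theorem laplacian_greenPlus (κ : ℂ) {x z : R3} (hx : x ≠ z) :
    Δ (fun y => greenPlus κ ‖y - z‖) x = -κ ^ 2 * greenPlus κ ‖x - z‖ := by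
  have hd := contDiffAt_greenPlus κ hx
  simp_rw [greenPlus_eq_radial] at hd ⊢
  rw [laplacian_radial (g := fun r => -(4 * (Real.pi : ℂ))⁻¹ * Complex.exp (Complex.I * κ * r))
    (fun r => (hasDerivAt_exp_I_mul κ r).const_mul _)
    (fun r => ((hasDerivAt_exp_I_mul κ r).const_mul _).const_mul _) hx hd]
  rw [mul_div_assoc', ← mul_assoc (Complex.I * κ)]
  congr 1
  linear_combination (-(4 * (Real.pi : ℂ))⁻¹ * κ ^ 2 *
    Complex.exp (Complex.I * κ * ‖x - z‖)) * Complex.I_sq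

/-- This is the bound `|e^w - 1 - w| ≤ |w|²` at `w = iκr`, divided by `r`. -/
theorem greenPlus_expansion (κ : ℂ) (z : R3) :
    (fun x : R3 => greenPlus κ ‖x - z‖ - (-(4 * (Real.pi : ℂ))⁻¹ / ‖x - z‖
      - Complex.I * κ / (4 * (Real.pi : ℂ)))) =O[𝓝[≠] z] fun x : R3 => ‖x - z‖ := by
  have hsmall : ∀ᶠ x in 𝓝 z, ‖Complex.I * κ * (‖x - z‖ : ℂ)‖ < 1 := by
    have hc : Continuous fun x : R3 => ‖Complex.I * κ * (‖x - z‖ : ℂ)‖ := by fun_prop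
    exact hc.continuousAt.eventually_lt continuousAt_const (by simp)
  refine Asymptotics.IsBigO.of_bound (‖-(4 * (Real.pi : ℂ))⁻¹‖ * ‖κ‖ ^ 2) ?_
  filter_upwards [nhdsWithin_le_nhds hsmall, self_mem_nhdsWithin] with x hx hxz
  have hr : 0 < ‖x - z‖ := norm_pos_iff.mpr (sub_ne_zero.mpr hxz)
  have hr' : (‖x - z‖ : ℂ) ≠ 0 := by exact_mod_cast hr.ne'
  have hpi : (Real.pi : ℂ) ≠ 0 := by exact_mod_cast Real.pi_ne_zero
  have h1 : greenPlus κ ‖x - z‖ - (-(4 * (Real.pi : ℂ))⁻¹ / ‖x - z‖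
      - Complex.I * κ / (4 * (Real.pi : ℂ))) = -(4 * (Real.pi : ℂ))⁻¹ *
      ((Complex.exp (Complex.I * κ * ‖x - z‖) - 1 - Complex.I * κ * ‖x - z‖) / ‖x - z‖) := by
    rw [greenPlus_eq_radial]
    field_simp
    ring
  have h2 := Complex.norm_exp_sub_one_sub_id_le hx.le
  rw [h1, norm_mul, mul_assoc ‖-(4 * (Real.pi : ℂ))⁻¹‖]
  refine mul_le_mul_of_nonneg_left ?_ (norm_nonneg (-(4 * (Real.pi : ℂ))⁻¹))
  rw [norm_div, Complex.norm_real, norm_norm, div_le_iff₀ hr]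
  refine h2.trans (le_of_eq ?_)
  simp
  ring

theorem ContDiffAt.isBigO_sub_norm {f : R3 → ℂ} {z : R3} (hf : ContDiffAt ℝ 2 f z) :
    (fun x => f x - f z) =O[𝓝[≠] z] fun x => ‖x - z‖ :=
  ((hf.differentiableAt (by norm_num)).isBigO_sub.mono nhdsWithin_le_nhds).norm_right

/-! ### Superpositions of point sources -/

section Superposition

variable {n : ℕ} (z : Fin n → R3) (κ : ℂ) (q : Fin n → ℂ)

theorem ne_of_notMem_range {z : Fin n → R3} {x : R3} (hx : x ∉ Set.range z) (j : Fin n) :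
    x ≠ z j := fun h => hx ⟨j, h.symm⟩

theorem contDiffAt_sum_greenPlus {x : R3} (hx : x ∉ Set.range z) :
    ContDiffAt ℝ 2 (fun y => ∑ j, q j * greenPlus κ ‖y - z j‖) x :=
  ContDiffAt.sum fun j _ =>
    contDiffAt_const.mul (contDiffAt_greenPlus κ (ne_of_notMem_range hx j))

theorem laplacian_sum_greenPlus {x : R3} (hx : x ∉ Set.range z) :
    Δ (fun y => ∑ j, q j * greenPlus κ ‖y - z j‖) x =
      -κ ^ 2 * ∑ j, q j * greenPlus κ ‖x - z j‖ := by
  have hd : ∀ j, ContDiffAt ℝ 2 (fun y => greenPlus κ ‖y - z j‖) x := fun j =>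
    contDiffAt_greenPlus κ (ne_of_notMem_range hx j)
  have hs : ∀ s : Finset (Fin n), Δ (fun y => ∑ j ∈ s, q j * greenPlus κ ‖y - z j‖) x =
      ∑ j ∈ s, q j * (-κ ^ 2 * greenPlus κ ‖x - z j‖) := fun s => by
    classical
    induction s using Finset.induction_on with
    | empty => simp [InnerProductSpace.laplacian_eq_iteratedFDeriv_stdOrthonormalBasis]
    | insert j s hj ih =>
      simp_rw [Finset.sum_insert hj]
      have h1 : ContDiffAt ℝ 2 (fun y => q j * greenPlus κ ‖y - z j‖) x :=
        contDiffAt_const.mul (hd j)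
      have h2 : ContDiffAt ℝ 2 (fun y => ∑ j ∈ s, q j * greenPlus κ ‖y - z j‖) x :=
        ContDiffAt.sum fun j _ => contDiffAt_const.mul (hd j)
      have h3 := InnerProductSpace.laplacian_smul (q j) (hd j)
      rw [laplacian_greenPlus κ (ne_of_notMem_range hx j)] at h3
      rw [← ih]
      refine (h1.laplacian_add h2).trans ?_
      rw [← smul_eq_mul, ← h3]
      rfl
  rw [hs, Finset.mul_sum]
  exact Finset.sum_congr rfl fun j _ => by ring

theorem eventually_notMem_range (z : Fin n → R3) (w : R3) : ∀ᶠ x in 𝓝[≠] w, x ∉ Set.range z := by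
  have h : IsClosed (Set.range z \ {w}) := ((Set.finite_range z).sdiff).isClosed
  filter_upwards [nhdsWithin_le_nhds (h.isOpen_compl.mem_nhds (by simp : w ∈ _)),
    self_mem_nhdsWithin] with x hx hxw hxr using hx ⟨hxr, hxw⟩

/-- The diagonal of `A` without `α j` is the constant term of the source at `z j`; the off-diagonal
entries are the values there of the other sources, smooth near `z j` as the points are distinct. -/
theorem sum_greenPlus_expansion {z : Fin n → R3} (hz : Function.Injective z) (α : Fin n → ℝ)
    (j : Fin n) :
    (fun x : R3 => ∑ j', q j' * greenPlus κ ‖x - z j'‖ -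
      (-(4 * (Real.pi : ℂ))⁻¹ * q j / ‖x - z j‖ +
        (Matrix.mulVec (scattererMatrix z α κ) q j - α j * q j)))
      =O[𝓝[≠] z j] fun x : R3 => ‖x - z j‖ := by
  have hterm : ∀ j', (fun x : R3 => q j' * (greenPlus κ ‖x - z j'‖ -
      if j' = j then -(4 * (Real.pi : ℂ))⁻¹ / ‖x - z j‖ - Complex.I * κ / (4 * (Real.pi : ℂ))
      else greenPlus κ ‖z j - z j'‖)) =O[𝓝[≠] z j] fun x : R3 => ‖x - z j‖ := fun j' => by
    refine Asymptotics.IsBigO.const_mul_left ?_ _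
    by_cases h : j' = j
    · subst h
      simpa using greenPlus_expansion κ (z j')
    · simp only [h, if_false]
      exact (contDiffAt_greenPlus κ fun h' => h (hz h').symm).isBigO_sub_norm
  refine (Asymptotics.IsBigO.sum (s := Finset.univ) fun j' _ => hterm j').congr_left fun x => ?_
  have h1 : -(4 * (Real.pi : ℂ))⁻¹ * q j / ‖x - z j‖ - α j * q j =
      ∑ j', if j' = j then -(4 * (Real.pi : ℂ))⁻¹ * q j' / ‖x - z j‖ - α j * q j' else 0 := by
    simp
  rw [add_sub_left_comm, h1, Matrix.mulVec, dotProduct, ← Finset.sum_add_distrib,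
    ← Finset.sum_sub_distrib]
  rw [Finset.sum_apply]
  refine Finset.sum_congr rfl fun j' _ => ?_
  simp only [scattererMatrix, Matrix.of_apply]
  split_ifs <;> ring

end Superposition

/-! ### The equivalence -/

theorem proposition1 {n : ℕ} (z : Fin n → R3) (hz : Function.Injective z) (α : Fin n → ℝ)
    (E κ : ℂ) (hκ : κ ^ 2 = E) (hκ_nonneg : ∀ e : ℝ, 0 ≤ e → E = (e : ℂ) → κ = (Real.sqrt e : ℂ))
    (ψ : R3 → ℂ) :
    SolvesMultipoint z α E ψ ↔
      ∃ (ψ₀ : R3 → ℂ) (q : Fin n → ℂ),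
        SolvesHelmholtzOn E Set.univ ψ₀ ∧
        Matrix.mulVec (scattererMatrix z α κ) q = (fun j => -ψ₀ (z j)) ∧
        ∀ x ∉ Set.range z, ψ x = ψ₀ x + ∑ j, q j * greenPlus κ ‖x - z j‖ := by
  classical
  subst hκ
  have hpi : (Real.pi : ℂ) ≠ 0 := by exact_mod_cast Real.pi_ne_zero
  have hopen : IsOpen (Set.range z)ᶜ := (Set.finite_range z).isClosed.isOpen_compl
  constructor
  · rintro ⟨⟨hψd, hψe⟩, hψz⟩
    choose a b hab hb using hψz
    set q : Fin n → ℂ := fun j => -(4 * (Real.pi : ℂ)) * a j with hq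
    set S : R3 → ℂ := fun x => ∑ j, q j * greenPlus κ ‖x - z j‖ with hS
    -- The values at the points are those the linear system demands, so only continuity has to be
    -- checked.
    set ψ₀ : R3 → ℂ := fun x =>
      if h : ∃ j, z j = x then -Matrix.mulVec (scattererMatrix z α κ) q h.choose
      else ψ x - S x with hψ₀
    have hval : ∀ j, ψ₀ (z j) = -Matrix.mulVec (scattererMatrix z α κ) q j := fun j => by
      have h : ∃ j', z j' = z j := ⟨j, rfl⟩
      simp only [hψ₀, dif_pos h]
      rw [hz h.choose_spec]
    have hoff : ∀ x ∉ Set.range z, ψ₀ x = ψ x - S x := fun x hx => by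
      simp only [hψ₀]
      exact dif_neg hx
    have hreg : ∀ x ∉ Set.range z, ContDiffAt ℝ 2 ψ₀ x ∧ -Δ ψ₀ x = κ ^ 2 * ψ₀ x := fun x hx => by
      have hev : ψ₀ =ᶠ[𝓝 x] ψ + -S := by
        filter_upwards [hopen.mem_nhds hx] with y hy
        rw [hoff y hy, Pi.add_apply, Pi.neg_apply, sub_eq_add_neg]
      have h1 : ContDiffAt ℝ 2 ψ x := hψd.contDiffAt (hopen.mem_nhds hx)
      have h2 : ContDiffAt ℝ 2 S x := contDiffAt_sum_greenPlus z κ q hx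
      refine ⟨(h1.add h2.neg).congr_of_eventuallyEq hev, ?_⟩
      have h3 : Δ S x = -κ ^ 2 * S x := laplacian_sum_greenPlus z κ q hx
      rw [(InnerProductSpace.laplacian_congr_nhds hev).eq_of_nhds, ContDiffAt.laplacian_add (f₂ := -S) h1 h2.neg,
        InnerProductSpace.laplacian_neg, Pi.neg_apply, h3, hoff x hx]
      linear_combination hψe x hx
    have hcont : Continuous ψ₀ := continuous_iff_continuousAt.mpr fun x => by
      by_cases hx : x ∈ Set.range z
      · obtain ⟨j, rfl⟩ := hx
        have hO : (fun x => ψ₀ x - ψ₀ (z j)) =O[𝓝[≠] z j] fun x => ‖x - z j‖ := by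
          -- The singular parts cancel by the choice of `q`, and `b j = -α j q j` turns the
          -- difference of constant terms into `-(Aq) j`.
          refine ((hab j).sub (sum_greenPlus_expansion κ q hz α j)).congr' ?_ .rfl
          filter_upwards [eventually_notMem_range z (z j)] with y hy
          rw [hval, hoff y hy, hb]
          simp only [hq, hS]
          field_simp
          ring
        have hlim : Filter.Tendsto (fun x => ‖x - z j‖) (𝓝[≠] z j) (𝓝 0) := by
          have hc : Continuous fun x => ‖x - z j‖ := by fun_prop
          have := hc.tendsto (z j)
          simp only [sub_self, norm_zero] at this
          exact this.mono_left nhdsWithin_le_nhds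
        exact continuousAt_iff_punctured_nhds.mpr
          (tendsto_sub_nhds_zero_iff.mp (hO.trans_tendsto hlim))
      · exact (hreg x hx).1.continuousAt
    refine ⟨ψ₀, q, ?_, ?_, fun x hx => ?_⟩
    · exact solvesHelmholtzOn_univ_of_finset hcont (Finset.univ.image z) fun x hx =>
        hreg x (by simpa using hx)
    · ext j
      rw [hval, neg_neg]
    · rw [hoff x hx]
      ring
  · rintro ⟨ψ₀, q, ⟨hd, he⟩, hA, hψ⟩
    have hd' : ContDiff ℝ 2 ψ₀ := contDiffOn_univ.mp hd
    set S : R3 → ℂ := fun x => ∑ j, q j * greenPlus κ ‖x - z j‖ with hS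
    have hev : ∀ x ∉ Set.range z, ψ =ᶠ[𝓝 x] ψ₀ + S := fun x hx => by
      filter_upwards [hopen.mem_nhds hx] with y hy using hψ y hy
    refine ⟨⟨fun x hx => ?_, fun x hx => ?_⟩, fun j => ?_⟩
    · exact ((hd'.contDiffAt.add (contDiffAt_sum_greenPlus z κ q hx)).congr_of_eventuallyEq
        (hev x hx)).contDiffWithinAt
    · have h3 : Δ S x = -κ ^ 2 * S x := laplacian_sum_greenPlus z κ q hx
      rw [(InnerProductSpace.laplacian_congr_nhds (hev x hx)).eq_of_nhds,
        hd'.contDiffAt.laplacian_add (contDiffAt_sum_greenPlus z κ q hx), h3, hψ x hx]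
      linear_combination he x (Set.mem_univ x)
    -- The constant term is `ψ₀(z j) + (Aq) j - α j q j`, which `hA` reduces to `-α j q j`.
    · refine ⟨-(4 * (Real.pi : ℂ))⁻¹ * q j, -α j * q j, ?_, ?_⟩
      · refine ((hd'.contDiffAt (x := z j)).isBigO_sub_norm.add
          (sum_greenPlus_expansion κ q hz α j)).congr' ?_ .rfl
        filter_upwards [eventually_notMem_range z (z j)] with y hy
        rw [hψ y hy, hA]
        ring
      · field_simp
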